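/- Let $\Omega=\{0,1\}^{\mathbb N}$ be the space of infinite binary sequences with the uniform Bernoulli distribution $P$, and let $\Sigma$ be the space of all finite and infinite binary sequences. A mapping $T\colon\Omega\to\Sigma$ is called computable if there is an oracle machine that, given read access to the bits of $\omega\in\Omega$, writes sequentially on its output tape exactly the bits of $T(\omega)$. A sequence $\omega\in\Omega$ is Martin-Löf random if there is no uniformly computably enumerable sequence of open sets $U_0,U_1,\dots\subseteq\Omega$ with $P(U_k)\le 2^{-k}$ for all $k$ and $\omega\in\bigcap_k U_k$. Theorem (Gács–Kučera, in Levin's form). There exist a computable mapping $T\colon\Omega\to\Sigma$ and a constant $c$ such that: (a) $T$ uses only the first $2n+c$ input bits to produce $n$ output bits: $T$ is computed by an oracle machine that, on every input and for every $n$, reads only bits among the first $2n+c$ bits of the input as long as it has written fewer than $n$ output bits; in particular, for all $n$ and all $\omega,\omega'\in\Omega$ with the same first $2n+c$ bits, the first $n$ bits of $T(\omega)$ and $T(\omega')$ coincide (including which of these bits exist); (b) for every infinite binary sequence $\alpha$ there exists a Martin-Löf random sequence $\omega$ such that $T(\omega)=\alpha$; moreover, $\alpha$ is Turing-reducible to $\omega$.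 Consequently, every infinite binary sequence is Turing-reducible to some Martin-Löf random sequence. -/

import Mathlib

open MeasureTheory
open scoped ENNReal

/-- The space `Ω` of infinite binary sequences. -/
abbrev BinSeq : Type := ℕ → Bool

/-- The space `Σ` of finite and infinite binary sequences: an element `s` has entries
`s.get? 0, s.get? 1, …`, which are `none` from the end of `s` on if `s` is finite. -/
abbrev FinInfSeq : Type := Stream'.Seq Bool

/-- An infinite sequence, viewed as an element of `Σ`. -/
def BinSeq.toFinInf (α : BinSeq) : FinInfSeq := Stream'.Seq.ofStream α

/-- The cone of all infinite sequences that have the finite string `x` as a prefix. -/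
def cone (x : List Bool) : Set BinSeq :=
  {ω | ∀ (i : ℕ) (h : i < x.length), ω i = x[i]}

/-- The uniform Bernoulli distribution on `Ω`: the bits are independent fair coin tosses. -/
noncomputable def uniformBernoulli : Measure BinSeq :=
  Measure.infinitePi fun _ : ℕ => (PMF.uniformOfFintype Bool).toMeasure

/-- The open subset of `Ω` generated by the strings that `W` lists at level `k`. -/
def levelSet (W : Set (ℕ × List Bool)) (k : ℕ) : Set BinSeq :=
  {ω | ∃ x : List Bool, (k, x) ∈ W ∧ ω ∈ cone x}

/-- A Martin-Löf test for the uniform distribution: a uniformly computably enumerable sequence of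
open sets, the `k`-th of which has measure at most `2 ^ (-k)`. -/
def IsMartinLofTest (W : Set (ℕ × List Bool)) : Prop :=
  REPred (fun p : ℕ × List Bool => p ∈ W) ∧
    ∀ k : ℕ, uniformBernoulli (levelSet W k) ≤ (2⁻¹ : ℝ≥0∞) ^ k

/-- `ω` is Martin-Löf random with respect to the uniform distribution: no Martin-Löf test
contains `ω` in all of its levels. -/
def IsMartinLofRandom (ω : BinSeq) : Prop :=
  ∀ W : Set (ℕ × List Bool), IsMartinLofTest W → ∃ k : ℕ, ω ∉ levelSet W k

/-- An oracle machine with read access to an infinite bit sequence and a one-way, write-only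
output tape. The internal configurations (state, work tapes, head positions) are coded by natural
numbers, the initial one by `0`. In configuration `q` the machine may read the input bit at the
position `query q`, may append the bit `write q` to the output, and passes to the configuration
`next q a`, where `a` is the bit that was read, if any. Each of these is a computable function of
finite data, so the input is accessible only bit by bit, through the queries. A machine that halts
is one that from some moment on neither reads nor writes. -/
structure OracleMachine where
  query : ℕ → Option ℕ
  write : ℕ → Option Bool
  next : ℕ → Option Bool → ℕ
  computable_query : Computable query
  computable_write : Computable write
  computable_next : Computable₂ next

namespace OracleMachine

/-- The configuration and the content of the output tape after `t` steps on input `ω`. -/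
def run (M : OracleMachine) (ω : BinSeq) : ℕ → ℕ × List Bool
  | 0 => (0, [])
  | t + 1 =>
    (M.next (M.run ω t).1 ((M.query (M.run ω t).1).map ω),
      (M.run ω t).2 ++ (M.write (M.run ω t).1).toList)

/-- `M` computes the mapping `T : Ω → Σ`: for every input `ω`, the sequence `T ω` is the (finite or
infinite) sequence of all bits that `M` ever writes on input `ω`. -/
def Computes (M : OracleMachine) (T : BinSeq → FinInfSeq) : Prop :=
  ∀ (ω : BinSeq) (n : ℕ) (b : Bool),
    (T ω).get? n = some b ↔ ∃ t : ℕ, (M.run ω t).2[n]? = some b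

/-- On every input, every bit read while the output has length `k` is among the first `u (k + 1)`
bits of the input. For monotone `u` this says that `M` reads only the first `u n` input bits to
produce `n` output bits. -/
def UseBoundedBy (M : OracleMachine) (u : ℕ → ℕ) : Prop :=
  ∀ (ω : BinSeq) (t i : ℕ),
    M.query (M.run ω t).1 = some i → i < u ((M.run ω t).2.length + 1)

end OracleMachine

/-- The first `n` bits of `T ω` (including whether they are there) depend only on the first `u n`
bits of `ω`. -/
def OutputDependsOnFirst (T : BinSeq → FinInfSeq) (u : ℕ → ℕ) : Prop :=
  ∀ (n : ℕ) (ω ω' : BinSeq), (∀ i < u n, ω i = ω' i) →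
    ∀ m < n, (T ω).get? m = (T ω').get? m

/-- A binary sequence as a (total) number-theoretic function. -/
def BinSeq.toPFun (ω : BinSeq) : ℕ →. ℕ := fun n => Part.some (ω n).toNat

/-! Fix a universal test: an effectively open set of measure at most `1/2` outside of which every
sequence is Martin-Löf random. Build in stages a growing table that assigns to input strings of
length `2 * n` output strings of length `n`, where the inputs of a successor of `x` extend inputs of
`x` by two bits. Call an input live if the universal test has not yet rejected it. Whenever the live
inputs of `x` have measure below `2 ^ (-(2n + 1))`, with `n` the length of `x`, half of a single
cell `2 ^ (-2n)`, one more free cell is given to `x`.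

No nonempty `x` ever holds more than `1/2 + 1` cells of live measure (`measure_live_alloc_le`).
Measured in units of `2 ^ (-(2n + 3))`, a parent that is not poor has at least 4, a poor child less
than 1, its sibling at most 3. So the parent always has live room left for the poor child
(`exists_isFree`, `length_cellsOf_alloc_lt`). As `x` can receive only finitely many cells, it is
eventually never poor (`eventually_not_isPoor`). By compactness each `α` then has a preimage outside
the universal test (`exists_preimage`).

The machine reads two bits, waits until the table assigns an output to the bits read so far, and
writes its last bit; hence `2 * n` bits suffice and `c = 0`. Strings are stored backwards: appending
a bit is a cons, a prefix becomes a suffix, and the parent of `x` is its tail. -/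

/-! ### Finite prefixes and the uniform measure of clopen sets -/

/-- The first `n` bits of `ω`, listed backwards: the most recently read bit comes first. -/
def revPrefix (ω : BinSeq) : ℕ → List Bool
  | 0 => []
  | n + 1 => ω n :: revPrefix ω n

@[simp] theorem length_revPrefix (ω : BinSeq) (n : ℕ) : (revPrefix ω n).length = n := by
  induction n with
  | zero => rfl
  | succ n ih => simp [revPrefix, ih]

theorem revPrefix_suffix (ω : BinSeq) {m n : ℕ} (h : m ≤ n) :
    revPrefix ω m <:+ revPrefix ω n := by
  induction n, h using Nat.le_induction with
  | base => exact List.suffix_rfl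
  | succ n _ ih => exact ih.trans (List.suffix_cons _ _)

theorem suffix_revPrefix_iff (ω : BinSeq) {y : List Bool} {n : ℕ} (h : y.length ≤ n) :
    y <:+ revPrefix ω n ↔ revPrefix ω y.length = y := by
  constructor
  · intro hy
    have := List.suffix_of_suffix_length_le (revPrefix_suffix ω h) hy (by simp)
    exact this.eq_of_length (by simp)
  · intro hy
    rw [← hy]
    exact revPrefix_suffix ω (by simpa using h)

theorem getElem_reverse_revPrefix (ω : BinSeq) (n i : ℕ) (h : i < (revPrefix ω n).reverse.length) :
    (revPrefix ω n).reverse[i] = ω i := by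
  induction n with
  | zero => simp [revPrefix] at h
  | succ n ih =>
    simp only [revPrefix, List.reverse_cons]
    rw [List.getElem_append]
    split_ifs with hi
    · exact ih hi
    · simp at hi
      simp at h
      have : i = n := by omega
      subst this
      simp

theorem mem_cone_iff (ω : BinSeq) (x : List Bool) :
    ω ∈ cone x ↔ revPrefix ω x.length = x.reverse := by
  rw [List.reverse_eq_iff.symm.trans eq_comm]
  constructor
  · intro h
    refine (List.ext_getElem (by simp) fun i h₁ h₂ => ?_)
    rw [getElem_reverse_revPrefix]
    exact (h i h₁).symm
  · intro h i hi
    conv_rhs => rw [List.getElem_of_eq h, getElem_reverse_revPrefix]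

/-- The open set of all sequences that begin with one of the (backwards) strings in `L`. -/
def openOf (L : List (List Bool)) : Set BinSeq :=
  {ω | ∃ y ∈ L, revPrefix ω y.length = y}

/-- The backwards string `z` begins with one of the backwards strings in `L`. -/
abbrev Hits (L : List (List Bool)) (z : List Bool) : Prop := ∃ y ∈ L, y <:+ z

/-- With no string of `L` longer than `n`, the first `n` bits decide membership. Measures thus
become counts of strings of length `n`, which a computation can compare with a threshold. -/
theorem hits_revPrefix_iff {L : List (List Bool)} {n : ℕ} (h : ∀ y ∈ L, y.length ≤ n)
    (ω : BinSeq) : Hits L (revPrefix ω n) ↔ ω ∈ openOf L :=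
  exists_congr fun _ => and_congr_right fun hy => suffix_revPrefix_iff ω (h _ hy)

theorem openOf_mono {L L' : List (List Bool)} (h : L ⊆ L') : openOf L ⊆ openOf L' :=
  fun _ ⟨y, hy, e⟩ => ⟨y, h hy, e⟩

/-- All binary strings of length `n`. -/
def boolStrings : ℕ → List (List Bool)
  | 0 => [[]]
  | n + 1 => (boolStrings n).flatMap fun z => [false :: z, true :: z]

@[simp] theorem mem_boolStrings {n : ℕ} {z : List Bool} : z ∈ boolStrings n ↔ z.length = n := by
  induction n generalizing z with
  | zero => simp [boolStrings]
  | succ n ih =>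
    simp only [boolStrings, List.mem_flatMap, ih]
    cases z with
    | nil => simp
    | cons b z => cases b <;> simp

theorem nodup_boolStrings (n : ℕ) : (boolStrings n).Nodup := by
  induction n with
  | zero => simp [boolStrings]
  | succ n ih =>
    rw [boolStrings, List.nodup_flatMap]
    refine ⟨fun _ _ => by simp, ih.imp fun {a b} hab => ?_⟩
    simp [Function.onFun, Ne.symm hab]

instance : IsProbabilityMeasure uniformBernoulli := by
  unfold uniformBernoulli; infer_instance

theorem isOpen_setOf_revPrefix (n : ℕ) (Q : List Bool → Prop) :
    IsOpen {ω | Q (revPrefix ω n)} := by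
  induction n generalizing Q with
  | zero => exact (isOpen_const : IsOpen {_ω : BinSeq | Q []})
  | succ n ih =>
    have : {ω : BinSeq | Q (revPrefix ω (n + 1))} =
        ⋃ b : Bool, {ω | ω n = b} ∩ {ω | Q (b :: revPrefix ω n)} := by
      ext ω; simp only [revPrefix, Set.mem_ofPred_eq, Set.mem_iUnion, Set.mem_inter_iff]
      simp
    rw [this]
    refine isOpen_iUnion fun b => IsOpen.inter ?_ (ih fun z => Q (b :: z))
    exact (isOpen_discrete ({b} : Set Bool)).preimage
      (continuous_apply n : Continuous fun ω : BinSeq => ω n)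

theorem isClosed_setOf_revPrefix (n : ℕ) (Q : List Bool → Prop) :
    IsClosed {ω | Q (revPrefix ω n)} :=
  ⟨isOpen_setOf_revPrefix n fun z => ¬ Q z⟩

theorem measurableSet_setOf_revPrefix (n : ℕ) (Q : List Bool → Prop) :
    MeasurableSet {ω | Q (revPrefix ω n)} :=
  (isOpen_setOf_revPrefix n Q).measurableSet

theorem isOpen_openOf (L : List (List Bool)) : IsOpen (openOf L) := by
  have : openOf L = ⋃ y ∈ L, {ω | revPrefix ω y.length = y} := by
    ext ω; simp [openOf]
  rw [this]
  exact isOpen_biUnion fun y _ => isOpen_setOf_revPrefix _ (· = y)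

theorem setOf_revPrefix_eq_pi (α : BinSeq) (n : ℕ) :
    {ω | revPrefix ω n = revPrefix α n} = Set.pi (Finset.range n) fun i => {α i} := by
  ext ω
  induction n with
  | zero => simp [revPrefix]
  | succ n ih =>
    simp [revPrefix] at ih ⊢
    rw [ih]
    constructor
    · rintro ⟨h₁, h₂⟩ i hi
      rcases hi.lt_or_eq with h | rfl
      exacts [h₂ i h, h₁]
    · exact fun h => ⟨h n (by omega), fun i hi => h i (by omega)⟩

theorem exists_revPrefix_eq (z : List Bool) : ∃ α : BinSeq, revPrefix α z.length = z := by
  refine ⟨fun i => z.reverse.getD i false, ?_⟩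
  have h : (fun i => z.reverse.getD i false) ∈ cone z.reverse :=
    fun i hi => List.getD_eq_getElem _ _ hi
  simpa using (mem_cone_iff _ _).1 h

theorem uniformBernoulli_revPrefix_eq (z : List Bool) :
    uniformBernoulli.real {ω | revPrefix ω z.length = z} = (2 ^ z.length)⁻¹ := by
  obtain ⟨α, hα⟩ := exists_revPrefix_eq z
  conv_lhs => rw [← hα, length_revPrefix, setOf_revPrefix_eq_pi]
  rw [Measure.real, uniformBernoulli, Measure.infinitePi_pi _ (by simp)]
  simp

theorem uniformBernoulli_setOf_revPrefix (n : ℕ) (Q : List Bool → Prop) [DecidablePred Q] :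
    uniformBernoulli.real {ω | Q (revPrefix ω n)} =
      ((boolStrings n).filter fun z => Q z).length / 2 ^ n := by
  have h : {ω | Q (revPrefix ω n)} =
      ⋃ z ∈ ((boolStrings n).filter fun z => Q z).toFinset, {ω | revPrefix ω n = z} := by
    ext ω; simp
  rw [h, measureReal_biUnion_finset]
  · rw [Finset.sum_congr rfl (g := fun _ => ((2 : ℝ) ^ n)⁻¹), Finset.sum_const,
      List.toFinset_card_of_nodup ((nodup_boolStrings n).filter _), nsmul_eq_mul, div_eq_mul_inv]
    intro z hz
    simp at hz
    obtain ⟨rfl, -⟩ := hz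
    exact uniformBernoulli_revPrefix_eq z
  · intro a _ b _ hab
    exact Set.disjoint_left.2 fun ω h₁ h₂ => hab (h₁.symm.trans h₂)
  · exact fun z _ => measurableSet_setOf_revPrefix n (· = z)

theorem uniformBernoulli_openOf {L : List (List Bool)} {n : ℕ} (h : ∀ y ∈ L, y.length ≤ n) :
    uniformBernoulli.real (openOf L) =
      ((boolStrings n).filter fun z => Hits L z).length / 2 ^ n := by
  rw [← uniformBernoulli_setOf_revPrefix]
  simp only [hits_revPrefix_iff h]
  rfl

/-! ### Primitive recursive operations on strings -/

theorem primrec_boolStrings : Primrec boolStrings := by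
  refine (Primrec.nat_rec₁ [[]] (Primrec.list_flatMap Primrec.snd
    (g := fun _ z => [false :: z, true :: z]) ?_).to₂).of_eq fun n => ?_
  · exact Primrec.list_cons.comp (Primrec.list_cons.comp (Primrec.const false) Primrec.snd)
      (Primrec.list_cons.comp (Primrec.list_cons.comp (Primrec.const true) Primrec.snd)
        (Primrec.const []))
  · induction n with
    | zero => rfl
    | succ n ih => simp only [boolStrings, ← ih]

theorem primrecRel_suffix {α : Type*} [Primcodable α] :
    PrimrecRel fun y z : List α => y <:+ z := by
  refine PrimrecRel.of_eq (r := fun y z : List α => y = z.drop (z.length - y.length)) ?_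
    fun y z => List.suffix_iff_eq_drop.symm
  exact Primrec.eq.comp Primrec.fst (Primrec.list_drop.comp (Primrec.nat_sub.comp
    (Primrec.list_length.comp Primrec.snd) (Primrec.list_length.comp Primrec.fst)) Primrec.snd)

theorem primrecRel_hits : PrimrecRel Hits :=
  primrecRel_suffix.exists_mem_list

theorem primrec_two_pow : Primrec fun n : ℕ => 2 ^ n := by
  refine (Primrec.nat_rec₁ 1 (Primrec.nat_mul.comp Primrec.snd (Primrec.const 2)).to₂).of_eq
    fun n => ?_
  induction n with
  | zero => rfl
  | succ n ih => rw [pow_succ, ← ih]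

/-! ### The universal Martin-Löf test -/

/-- The binary string with code `n` (the empty string if there is none). -/
def decodeString (n : ℕ) : List Bool := (Encodable.decode n).getD []

@[simp] theorem decodeString_encode (x : List Bool) : decodeString (Encodable.encode x) = x := by
  simp [decodeString]

theorem primrec_decodeString : Primrec decodeString :=
  Primrec.option_getD.comp Primrec.decode (Primrec.const [])

open Encodable Denumerable Nat.Partrec in
/-- The strings `x` (written backwards) for which the `e`-th program is seen within `s` steps to
accept `(e + 2, x)`. -/
def acceptedStrings (e s : ℕ) : List (List Bool) :=
  ((List.range s).filter fun n => encode (decodeString n) = n ∧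
    (Code.evaln s (ofNat Code e) (encode (e + 2, decodeString n))).isSome).map
    fun n => (decodeString n).reverse

theorem mem_acceptedStrings {e s : ℕ} {y : List Bool} :
    y ∈ acceptedStrings e s ↔ Encodable.encode y.reverse < s ∧
      (Nat.Partrec.Code.evaln s (Denumerable.ofNat Nat.Partrec.Code e)
        (Encodable.encode (e + 2, y.reverse))).isSome := by
  simp only [acceptedStrings, List.mem_map, List.mem_filter, List.mem_range]
  constructor
  · rintro ⟨n, ⟨h₁, h₂⟩, rfl⟩
    simp only [decide_eq_true_eq] at h₂
    rw [List.reverse_reverse, h₂.1]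
    exact ⟨h₁, h₂.2⟩
  · rintro ⟨h₁, h₂⟩
    exact ⟨Encodable.encode y.reverse, by simpa using ⟨h₁, h₂⟩, by simp⟩

theorem length_le_of_mem_acceptedStrings {e s : ℕ} {y : List Bool}
    (h : y ∈ acceptedStrings e s) : y.length ≤ s := by
  have := Encodable.length_le_encode y.reverse
  rw [List.length_reverse] at this
  exact this.trans (mem_acceptedStrings.1 h).1.le

theorem acceptedStrings_mono (e : ℕ) {s t : ℕ} (h : s ≤ t) :
    acceptedStrings e s ⊆ acceptedStrings e t := by
  intro y hy
  rw [mem_acceptedStrings] at hy ⊢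
  obtain ⟨v, hv⟩ := Option.isSome_iff_exists.1 hy.2
  exact ⟨hy.1.trans_le h, Option.isSome_iff_exists.2 ⟨v, Nat.Partrec.Code.evaln_mono h hv⟩⟩

/-- The strings accepted by the `e`-th program within `s` steps cover a set of measure at most
`2 ^ (-(e + 2))`. -/
abbrev IsSmall (e s : ℕ) : Prop :=
  2 ^ (e + 2) * ((boolStrings s).filter fun z => Hits (acceptedStrings e s) z).length ≤ 2 ^ s

theorem isSmall_iff {e s : ℕ} :
    IsSmall e s ↔ uniformBernoulli.real (openOf (acceptedStrings e s)) ≤ (2⁻¹ : ℝ) ^ (e + 2) := by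
  rw [uniformBernoulli_openOf fun y hy => length_le_of_mem_acceptedStrings hy,
    div_le_iff₀ (by positivity), inv_pow, inv_mul_eq_div, le_div_iff₀ (by positivity), mul_comm,
    IsSmall]
  exact_mod_cast Iff.rfl

/-- The stage `s` approximation of the universal test: the strings accepted by the first `s`
programs, each truncated as soon as its measure becomes too big. -/
def universalStrings (s : ℕ) : List (List Bool) :=
  -- All stages `t ≤ s` are kept, so that a listed string is not withdrawn when program `e` later
  -- becomes too big.
  (List.range s).flatMap fun e => (List.range (s + 1)).flatMap fun t =>
    if IsSmall e t then acceptedStrings e t else []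

theorem mem_universalStrings {s : ℕ} {y : List Bool} :
    y ∈ universalStrings s ↔ ∃ e < s, ∃ t ≤ s, IsSmall e t ∧ y ∈ acceptedStrings e t := by
  simp only [universalStrings, List.mem_flatMap, List.mem_range, Nat.lt_succ_iff]
  refine exists_congr fun e => and_congr_right fun _ => exists_congr fun t =>
    and_congr_right fun _ => ?_
  split_ifs with h <;> simp [h]

theorem length_le_of_mem_universalStrings {s : ℕ} {y : List Bool}
    (h : y ∈ universalStrings s) : y.length ≤ s := by
  obtain ⟨e, _, t, ht, _, hy⟩ := mem_universalStrings.1 h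
  exact (length_le_of_mem_acceptedStrings hy).trans ht

theorem universalStrings_mono : ∀ {s t : ℕ}, s ≤ t → universalStrings s ⊆ universalStrings t := by
  intro s t h y hy
  obtain ⟨e, he, r, hr, h'⟩ := mem_universalStrings.1 hy
  exact mem_universalStrings.2 ⟨e, he.trans_le h, r, hr.trans h, h'⟩

/-- The sets accepted by program `e` grow with the stage, so its whole contribution is that of its
greatest small stage, at most `2⁻¹ ^ (e + 2)`. These bounds sum to at most `1/2`. -/
theorem uniformBernoulli_openOf_universalStrings (s : ℕ) :
    uniformBernoulli.real (openOf (universalStrings s)) ≤ 2⁻¹ := by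
  have hsub : openOf (universalStrings s) ⊆
      ⋃ e ∈ Finset.range s, {ω | ∃ t ≤ s, IsSmall e t ∧ ω ∈ openOf (acceptedStrings e t)} := by
    rintro ω ⟨y, hy, hω⟩
    obtain ⟨e, he, t, ht, hs, hy⟩ := mem_universalStrings.1 hy
    simp only [Set.mem_iUnion, Finset.mem_range]
    exact ⟨e, he, t, ht, hs, y, hy, hω⟩
  have hpart (e : ℕ) : uniformBernoulli.real
      {ω | ∃ t ≤ s, IsSmall e t ∧ ω ∈ openOf (acceptedStrings e t)} ≤ (2⁻¹ : ℝ) ^ (e + 2) := by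
    by_cases hex : ∃ t ≤ s, IsSmall e t
    · have hmax := Nat.findGreatest_spec (P := IsSmall e) hex.choose_spec.1 hex.choose_spec.2
      refine le_trans (measureReal_mono ?_) (isSmall_iff.1 hmax)
      rintro ω ⟨t, ht, hst, hω⟩
      exact openOf_mono (acceptedStrings_mono e (Nat.le_findGreatest ht hst)) hω
    · have : {ω | ∃ t ≤ s, IsSmall e t ∧ ω ∈ openOf (acceptedStrings e t)} = ∅ := by
        ext ω
        simp only [Set.mem_ofPred_eq, Set.mem_empty_iff_false, iff_false]
        exact fun ⟨t, ht, hst, _⟩ => hex ⟨t, ht, hst⟩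
      rw [this]
      simp
  have hsum (n : ℕ) : ∑ e ∈ Finset.range n, (2⁻¹ : ℝ) ^ (e + 2) = 2⁻¹ - (2⁻¹ : ℝ) ^ (n + 1) := by
    induction n with
    | zero => simp
    | succ n ih => rw [Finset.sum_range_succ, ih]; ring
  calc _ ≤ _ := measureReal_mono hsub (measure_ne_top _ _)
    _ ≤ _ := measureReal_biUnion_finset_le _ _
    _ ≤ ∑ e ∈ Finset.range s, (2⁻¹ : ℝ) ^ (e + 2) := Finset.sum_le_sum fun e _ => hpart e
    _ ≤ 2⁻¹ := by rw [hsum]; simp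

/-- If program `e` enumerates a test `W`, all it contributes lies in level `e + 2` of `W`, which is
within the bound of `IsSmall`. Hence it is never truncated, and the universal test covers that whole
level. -/
theorem isMartinLofRandom_of_forall_notMem {ω : BinSeq}
    (hω : ∀ s, ω ∉ openOf (universalStrings s)) : IsMartinLofRandom ω := by
  rintro W ⟨hW, hμ⟩
  by_contra! hall
  obtain ⟨c, hc⟩ := Nat.Partrec.Code.exists_code.1 hW
  obtain ⟨e, rfl⟩ : ∃ e, c = Denumerable.ofNat Nat.Partrec.Code e :=
    ⟨Encodable.encode c, by simp⟩
  have hmem (p : ℕ × List Bool) : p ∈ W ↔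
      ∃ v k, v ∈ Nat.Partrec.Code.evaln k (Denumerable.ofNat Nat.Partrec.Code e)
        (Encodable.encode p) := by
    simp_rw [← Nat.Partrec.Code.evaln_complete, hc, Encodable.encodek]
    simp
  obtain ⟨x, hx, hωx⟩ := hall (e + 2)
  obtain ⟨v, k, hk⟩ := (hmem _).1 hx
  have hsmall (t : ℕ) : IsSmall e t := by
    rw [isSmall_iff]
    refine ENNReal.toReal_le_of_le_ofReal (by positivity)
      ((measure_mono ?_).trans ((hμ (e + 2)).trans ?_))
    · rintro ω' ⟨y, hy, hω'⟩
      obtain ⟨v, hv⟩ := Option.isSome_iff_exists.1 (mem_acceptedStrings.1 hy).2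
      exact ⟨y.reverse, (hmem _).2 ⟨v, t, hv⟩, (mem_cone_iff _ _).2 (by simpa using hω')⟩
    · rw [ENNReal.ofReal_pow (by positivity), ENNReal.ofReal_inv_of_pos (by norm_num)]
      simp
  -- Acceptance takes `k` steps, and the code of `x` must lie strictly below the stage.
  let t := max k (Encodable.encode x + 1)
  refine hω (max (e + 1) t) ⟨x.reverse, mem_universalStrings.2
    ⟨e, by omega, t, le_max_right _ _, hsmall t, mem_acceptedStrings.2 ⟨?_, ?_⟩⟩, ?_⟩
  · rw [List.reverse_reverse]
    exact Nat.lt_of_succ_le (le_max_right _ _)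
  · rw [List.reverse_reverse]
    exact Option.isSome_iff_exists.2 ⟨v, Nat.Partrec.Code.evaln_mono (le_max_left _ _) hk⟩
  · rw [List.length_reverse]
    exact (mem_cone_iff _ _).1 hωx

theorem primrec_acceptedStrings : Primrec₂ acceptedStrings := by
  have hR : PrimrecRel fun (n : ℕ) (p : ℕ × ℕ) =>
      Encodable.encode (decodeString n) = n ∧ (Nat.Partrec.Code.evaln p.2 (Denumerable.ofNat Nat.Partrec.Code p.1)
        (Encodable.encode (p.1 + 2, decodeString n))).isSome = true := by
    have hx : Primrec fun q : ℕ × ℕ × ℕ => Encodable.encode (q.2.1 + 2, decodeString q.1) :=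
      Primrec.encode.comp (Primrec.pair
        (Primrec.nat_add.comp (Primrec.fst.comp Primrec.snd) (Primrec.const 2))
        (primrec_decodeString.comp Primrec.fst))
    have he := Nat.Partrec.Code.primrec_evaln.comp (Primrec.pair (Primrec.pair
      (Primrec.snd.comp Primrec.snd)
      ((Primrec.ofNat Nat.Partrec.Code).comp (Primrec.fst.comp Primrec.snd))) hx)
    exact (Primrec.eq.comp (Primrec.encode.comp (primrec_decodeString.comp Primrec.fst))
      Primrec.fst).and (Primrec.eq.comp (Primrec.option_isSome.comp he) (Primrec.const true))
  refine (Primrec.list_map (hR.listFilter.comp (Primrec.list_range.comp Primrec.snd) Primrec.id)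
    (g := fun _ n => (decodeString n).reverse)
    (Primrec.list_reverse.comp (primrec_decodeString.comp Primrec.snd))).of_eq fun p => ?_
  simp [acceptedStrings]

theorem primrecRel_isSmall : PrimrecRel IsSmall := by
  refine Primrec.nat_le.comp (Primrec.nat_mul.comp
    (primrec_two_pow.comp (Primrec.nat_add.comp Primrec.fst (Primrec.const 2)))
    (Primrec.list_length.comp ?_)) (primrec_two_pow.comp Primrec.snd)
  exact (PrimrecRel.listFilter primrecRel_hits.swap).comp
    (primrec_boolStrings.comp Primrec.snd) primrec_acceptedStrings

theorem primrec_universalStrings : Primrec universalStrings := by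
  have h : Primrec₂ fun (p : ℕ × ℕ) (t : ℕ) =>
      if IsSmall p.2 t then acceptedStrings p.2 t else [] :=
    Primrec.ite (primrecRel_isSmall.comp (Primrec.snd.comp Primrec.fst) Primrec.snd)
      (primrec_acceptedStrings.comp (Primrec.snd.comp Primrec.fst) Primrec.snd) (Primrec.const [])
  exact Primrec.list_flatMap Primrec.list_range (Primrec.list_flatMap
    (Primrec.list_range.comp (Primrec.succ.comp Primrec.fst)) h)

/-! ### The table of inputs and outputs, and its construction -/

/-- The (backwards) input strings to which the finite table `A` assigns the output `x`. -/
def cellsOf (A : List (List Bool × List Bool)) (x : List Bool) : List (List Bool) :=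
  (A.filter fun p => p.2 = x).map Prod.fst

@[simp] theorem mem_cellsOf {A : List (List Bool × List Bool)} {x y : List Bool} :
    y ∈ cellsOf A x ↔ (y, x) ∈ A := by
  simp [cellsOf]

/-- The sequences that `A` maps to extensions of `x` and that are not yet rejected by the
universal test at stage `s`. -/
def live (A : List (List Bool × List Bool)) (s : ℕ) (x : List Bool) : Set BinSeq :=
  openOf (cellsOf A x) \ openOf (universalStrings s)

/-- The live part of the preimage of `x` has measure less than `2 ^ (-(2 * |x| + 1))`. -/
abbrev IsPoor (A : List (List Bool × List Bool)) (s : ℕ) (x : List Bool) : Prop :=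
  2 ^ (2 * x.length + 1) * ((boolStrings (s + 2 * x.length)).filter fun z =>
    Hits (cellsOf A x) z ∧ ¬ Hits (universalStrings s) z).length < 2 ^ (s + 2 * x.length)

/-- `y` has not been assigned an output, and its cone is not yet covered by the universal test. -/
abbrev IsFree (A : List (List Bool × List Bool)) (s : ℕ) (y : List Bool) : Prop :=
  (∀ p ∈ A, p.1 ≠ y) ∧
    ∃ z ∈ boolStrings (s + y.length), y <:+ z ∧ ¬ Hits (universalStrings s) z

/-- The extensions by two bits of the inputs that are mapped to `x`. -/
def candidates (A : List (List Bool × List Bool)) (x : List Bool) : List (List Bool) :=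
  (cellsOf A x).flatMap fun y => (boolStrings 2).map (· ++ y)

/-- The first free input string that may be mapped to the non-empty output `x`. -/
def firstFree (A : List (List Bool × List Bool)) (s : ℕ) (x : List Bool) : Option (List Bool) :=
  ((candidates A x.tail).filter fun y => IsFree A s y).head?

/-- One step of the construction: if the output `x` considered at stage `s` is poor, then a free
input string is assigned to it. -/
def allocStep (A : List (List Bool × List Bool)) (s : ℕ) : List (List Bool × List Bool) :=
  if decodeString s.unpair.1 ≠ [] ∧ IsPoor A s (decodeString s.unpair.1) then
    ((firstFree A s (decodeString s.unpair.1)).map fun y => (y, decodeString s.unpair.1)).toList ++ A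
  else A

/-- The table constructed before stage `s`. -/
def alloc : ℕ → List (List Bool × List Bool)
  | 0 => [([], [])]
  | s + 1 => allocStep (alloc s) s

theorem mem_candidates {A : List (List Bool × List Bool)} {x y : List Bool} :
    y ∈ candidates A x ↔ ∃ b c y', y = b :: c :: y' ∧ (y', x) ∈ A := by
  simp only [candidates, List.mem_flatMap, mem_cellsOf, List.mem_map, mem_boolStrings]
  constructor
  · rintro ⟨y', hy', w, hw, rfl⟩
    obtain ⟨b, c, rfl⟩ := List.length_eq_two.1 hw
    exact ⟨b, c, y', rfl, hy'⟩
  · rintro ⟨b, c, y', rfl, hy'⟩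
    exact ⟨y', hy', [b, c], rfl, rfl⟩

theorem allocStep_eq (A : List (List Bool × List Bool)) (s : ℕ) :
    allocStep A s = A ∨ ∃ y x, allocStep A s = (y, x) :: A ∧ x ≠ [] ∧ IsPoor A s x ∧
      y ∈ candidates A x.tail ∧ IsFree A s y := by
  unfold allocStep
  split_ifs with h
  · cases hf : firstFree A s (decodeString s.unpair.1) with
    | none => exact Or.inl (by simp)
    | some y =>
      have hy := List.mem_of_mem_head? hf
      rw [List.mem_filter, decide_eq_true_eq] at hy
      exact Or.inr ⟨y, _, by simp, h.1, h.2, hy.1, hy.2⟩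
  · exact Or.inl rfl

theorem subset_allocStep (A : List (List Bool × List Bool)) (s : ℕ) : A ⊆ allocStep A s := by
  rcases allocStep_eq A s with h | ⟨y, x, h, -⟩ <;> rw [h]
  · exact List.Subset.refl _
  · exact List.subset_cons_self _ _

theorem alloc_mono {s t : ℕ} (h : s ≤ t) : alloc s ⊆ alloc t := by
  induction t, h using Nat.le_induction with
  | base => exact List.Subset.refl _
  | succ t _ ih => exact List.Subset.trans ih (subset_allocStep _ _)

/-- `A` is a finite table of a monotone map that produces one output bit for two input bits. -/
structure IsTable (A : List (List Bool × List Bool)) : Prop where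
  root : ([], []) ∈ A
  nodup : (A.map Prod.fst).Nodup
  length_eq : ∀ p ∈ A, p.1.length = 2 * p.2.length
  parent : ∀ p ∈ A, p.2 ≠ [] → ∃ b c y, p.1 = b :: c :: y ∧ (y, p.2.tail) ∈ A

theorem isTable_alloc (s : ℕ) : IsTable (alloc s) := by
  induction s with
  | zero => constructor <;> simp [alloc]
  | succ s ih =>
    rcases allocStep_eq (alloc s) s with h | ⟨y, x, h, hx, -, hy, hfree⟩
    · rwa [alloc, h]
    · obtain ⟨b, c, y', rfl, hy'⟩ := mem_candidates.1 hy
      rw [alloc, h]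
      refine ⟨List.mem_cons_of_mem _ ih.root, ?_, ?_, ?_⟩
      · rw [List.map_cons, List.nodup_cons]
        refine ⟨fun hmem => ?_, ih.nodup⟩
        obtain ⟨p, hp, e⟩ := List.mem_map.1 hmem
        exact hfree.1 p hp e
      · rintro p hp
        rcases List.mem_cons.1 hp with rfl | hp
        · have := ih.length_eq _ hy'
          have hpos := List.length_pos_iff.2 hx
          simp at this ⊢
          omega
        · exact ih.length_eq p hp
      · rintro p hp hne
        rcases List.mem_cons.1 hp with rfl | hp
        · exact ⟨b, c, y', rfl, List.mem_cons_of_mem _ hy'⟩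
        · obtain ⟨b, c, y, e, hm⟩ := ih.parent p hp hne
          exact ⟨b, c, y, e, List.mem_cons_of_mem _ hm⟩

namespace IsTable

variable {A : List (List Bool × List Bool)} (hA : IsTable A)
include hA

theorem output_unique {y x x' : List Bool} (h : (y, x) ∈ A) (h' : (y, x') ∈ A) : x = x' := by
  have := List.inj_on_of_nodup_map hA.nodup h h' rfl
  exact congrArg Prod.snd this

theorem mem_openOf_cellsOf {ω : BinSeq} {x : List Bool} :
    ω ∈ openOf (cellsOf A x) ↔ (revPrefix ω (2 * x.length), x) ∈ A := by
  constructor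
  · rintro ⟨y, hy, hω⟩
    rw [mem_cellsOf] at hy
    have hl : y.length = 2 * x.length := hA.length_eq _ hy
    rwa [← hl, hω]
  · intro h
    exact ⟨_, mem_cellsOf.2 h, by simp⟩

/-- The depth `s + 2 * x.length` bounds the length of every string involved, so the count in
`IsPoor` gives the measure exactly. -/
theorem isPoor_iff {s : ℕ} {x : List Bool} :
    IsPoor A s x ↔ uniformBernoulli.real (live A s x) < (2⁻¹ : ℝ) ^ (2 * x.length + 1) := by
  have hlive : live A s x = {ω | Hits (cellsOf A x) (revPrefix ω (s + 2 * x.length)) ∧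
      ¬ Hits (universalStrings s) (revPrefix ω (s + 2 * x.length))} := by
    ext ω
    simp only [Set.mem_ofPred_eq]
    rw [hits_revPrefix_iff, hits_revPrefix_iff]
    · rfl
    · exact fun y hy => (length_le_of_mem_universalStrings hy).trans (Nat.le_add_right _ _)
    · intro y hy
      have : y.length = 2 * x.length := hA.length_eq _ (mem_cellsOf.1 hy)
      omega
  rw [hlive, uniformBernoulli_setOf_revPrefix _
    fun z => Hits (cellsOf A x) z ∧ ¬ Hits (universalStrings s) z,
    div_lt_iff₀ (by positivity), inv_pow, inv_mul_eq_div, lt_div_iff₀ (by positivity), mul_comm,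
    IsPoor]
  exact_mod_cast Iff.rfl

/-- Inputs in the table are distinct and their length is fixed by `x`. This cap is what makes the
allocation to `x` come to an end. -/
theorem length_cellsOf_le (x : List Bool) :
    (cellsOf A x).length ≤ (boolStrings (2 * x.length)).length := by
  have hnd : (cellsOf A x).Nodup :=
    hA.nodup.sublist (List.filter_sublist.map _)
  refine (hnd.subperm fun y hy => ?_).length_le
  rw [mem_boolStrings]
  exact hA.length_eq _ (mem_cellsOf.1 hy)

/-- If the live part of the preimage of `x` is larger than those of its two successors together,
then it contains a free string. -/
theorem exists_isFree {s : ℕ} {x : List Bool}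
    (h : uniformBernoulli.real (live A s (false :: x)) + uniformBernoulli.real (live A s (true :: x)) <
      uniformBernoulli.real (live A s x)) :
    ∃ y ∈ candidates A x, IsFree A s y := by
  have hns : ¬ live A s x ⊆ live A s (false :: x) ∪ live A s (true :: x) := fun hsub =>
    absurd ((measureReal_mono hsub).trans (measureReal_union_le _ _)) (not_le.2 h)
  obtain ⟨ω, hω, hω'⟩ := Set.not_subset.1 hns
  have hU : ω ∉ openOf (universalStrings s) := hω.2
  have hx := hA.mem_openOf_cellsOf.1 hω.1
  refine ⟨revPrefix ω (2 * x.length + 2), mem_candidates.2 ⟨_, _, _, rfl, hx⟩, ?_, ?_⟩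
  · rintro ⟨y, x'⟩ hp (rfl : y = _)
    have hl := hA.length_eq _ hp
    simp only [length_revPrefix] at hl
    -- If the string already had an output `x'`, its parent entry would give `x'.tail = x`. Then `ω`
    -- would be live for a successor of `x`, against its choice.
    obtain ⟨b, c, y, e, hm⟩ := hA.parent _ hp (by rintro (rfl : x' = _); simp at hl)
    simp only [revPrefix, List.cons.injEq] at e
    obtain ⟨-, -, rfl⟩ := e
    have e := hA.output_unique hx hm
    obtain ⟨d, x'', rfl⟩ : ∃ d x'', x' = d :: x'' :=
      List.exists_cons_of_ne_nil (by rintro (rfl : x' = _); simp at hl)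
    rw [List.tail_cons] at e
    subst e
    apply hω'
    have hlive : ω ∈ live A s (d :: x) := by
      refine ⟨hA.mem_openOf_cellsOf.2 ?_, hU⟩
      rwa [List.length_cons, mul_add]
    cases d
    · exact Or.inl hlive
    · exact Or.inr hlive
  · refine ⟨revPrefix ω (s + (2 * x.length + 2)), by simp, by
      rw [suffix_revPrefix_iff] <;> simp, ?_⟩
    rwa [hits_revPrefix_iff]
    exact fun y hy => (length_le_of_mem_universalStrings hy).trans (Nat.le_add_right _ _)

end IsTable

/-! ### Measure bounds, stabilization and compactness -/

theorem live_anti_stage (A : List (List Bool × List Bool)) {s t : ℕ} (h : s ≤ t) (x : List Bool) :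
    live A t x ⊆ live A s x :=
  Set.sdiff_subset_sdiff_right (openOf_mono (universalStrings_mono h))

/-- Strings that get new input strings only when they are poor never become too rich. -/
theorem measure_live_alloc_le (s : ℕ) {x : List Bool} (hx : x ≠ []) :
    uniformBernoulli.real (live (alloc s) s x) ≤
      (2⁻¹ : ℝ) ^ (2 * x.length + 1) + (2⁻¹ : ℝ) ^ (2 * x.length) := by
  induction s with
  | zero =>
    have : live (alloc 0) 0 x = ∅ := by
      simp [live, alloc, cellsOf, openOf, hx.symm]
    rw [this, measureReal_empty]
    positivity
  | succ s ih =>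
    refine (measureReal_mono (live_anti_stage _ (Nat.le_succ s) x)).trans ?_
    rw [alloc]
    rcases allocStep_eq (alloc s) s with h | ⟨y, x', h, -, hpoor, hy, -⟩
    · rwa [h]
    · have hT := isTable_alloc (s + 1)
      rw [alloc] at hT
      rw [h] at hT ⊢
      by_cases hxx : x' = x
      · subst hxx
        -- The live part was below the poverty threshold, and the new cell adds at most `2 ^ (-2
        -- |x'|)`.
        have hsub : live ((y, x') :: alloc s) s x' ⊆
            live (alloc s) s x' ∪ {ω | revPrefix ω y.length = y} := by
          rintro ω ⟨⟨y', hy', hω⟩, hU⟩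
          rw [mem_cellsOf, List.mem_cons] at hy'
          rcases hy' with hy' | hy'
          · obtain rfl : y' = y := congrArg Prod.fst hy'
            exact Or.inr hω
          · exact Or.inl ⟨⟨y', mem_cellsOf.2 hy', hω⟩, hU⟩
        refine (measureReal_mono hsub).trans ((measureReal_union_le _ _).trans ?_)
        rw [uniformBernoulli_revPrefix_eq, ← inv_pow,
          show y.length = 2 * x'.length from hT.length_eq _ List.mem_cons_self]
        gcongr
        exact ((isTable_alloc s).isPoor_iff.1 hpoor).le
      · have : live ((y, x') :: alloc s) s x = live (alloc s) s x := by
          simp [live, cellsOf, hxx]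
        rwa [this]

/-- A poor string whose parent is not poor gets a new input string when it is considered. -/
theorem length_cellsOf_alloc_lt {s : ℕ} {b : Bool} {x : List Bool}
    (hs : decodeString s.unpair.1 = b :: x) (hpoor : IsPoor (alloc s) s (b :: x))
    (hparent : ¬ IsPoor (alloc s) s x) :
    (cellsOf (alloc s) (b :: x)).length < (cellsOf (alloc (s + 1)) (b :: x)).length := by
  have hT := isTable_alloc s
  obtain ⟨y, hy, hfree⟩ : ∃ y ∈ candidates (alloc s) x, IsFree (alloc s) s y := by
    apply hT.exists_isFree
    rw [hT.isPoor_iff, not_lt] at hparent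
    rw [hT.isPoor_iff] at hpoor
    have h₁ := measure_live_alloc_le s (x := false :: x) (by simp)
    have h₂ := measure_live_alloc_le s (x := true :: x) (by simp)
    -- In units of `2 ^ (-(2 |x| + 3))`: the parent has at least 4, the poor child less than 1, its
    -- sibling at most 3.
    have e : (2⁻¹ : ℝ) ^ (2 * x.length + 1) = 4 * (2⁻¹ : ℝ) ^ (2 * (x.length + 1) + 1) := by
      ring
    have e' : (2⁻¹ : ℝ) ^ (2 * (x.length + 1)) = 2 * (2⁻¹ : ℝ) ^ (2 * (x.length + 1) + 1) := by
      ring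
    simp only [List.length_cons] at h₁ h₂ hpoor
    cases b <;> linarith
  have hsome : ∃ y', firstFree (alloc s) s (b :: x) = some y' := by
    rw [← Option.isSome_iff_exists, firstFree, List.isSome_head?]
    exact List.ne_nil_of_mem (List.mem_filter.2 ⟨hy, decide_eq_true hfree⟩)
  obtain ⟨y', hy'⟩ := hsome
  rw [alloc, allocStep, hs, if_pos ⟨by simp, hpoor⟩, hy']
  simp [cellsOf]

theorem exists_const_of_monotone_of_le {f : ℕ → ℕ} (hf : Monotone f) {N : ℕ} (hN : ∀ n, f n ≤ N) :
    ∃ n₀, ∀ n ≥ n₀, f n = f n₀ := by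
  have hbdd : BddAbove (Set.range f) := ⟨N, by rintro _ ⟨n, rfl⟩; exact hN n⟩
  obtain ⟨n₀, h⟩ := Nat.sSup_mem (Set.range_nonempty f) hbdd
  exact ⟨n₀, fun n hn => le_antisymm (h ▸ le_csSup hbdd ⟨n, rfl⟩) (hf hn)⟩

theorem monotone_length_cellsOf_alloc (x : List Bool) :
    Monotone fun s => (cellsOf (alloc s) x).length := by
  refine monotone_nat_of_le_succ fun s => ?_
  rw [alloc]
  rcases allocStep_eq (alloc s) s with h | ⟨y, x', h, -⟩ <;> rw [h]
  by_cases hx : x' = x <;> simp [cellsOf, hx]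

/-- The root always keeps live measure at least `1/2`. Once `x` is no longer poor, a poor `b :: x`
gains a cell each time it is considered, whereas its number of cells is eventually constant. -/
theorem eventually_not_isPoor (x : List Bool) : ∃ s₀, ∀ s ≥ s₀, ¬ IsPoor (alloc s) s x := by
  induction x with
  | nil =>
    refine ⟨0, fun s _ => ?_⟩
    have hT := isTable_alloc s
    rw [hT.isPoor_iff, not_lt]
    have : live (alloc s) s [] = (openOf (universalStrings s))ᶜ := by
      ext ω
      simp only [live, Set.mem_sdiff, Set.mem_compl_iff, hT.mem_openOf_cellsOf]
      exact and_iff_right hT.root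
    rw [this, probReal_compl_eq_one_sub (isOpen_openOf _).measurableSet]
    have := uniformBernoulli_openOf_universalStrings s
    norm_num at this ⊢
    linarith
  | cons b x ih =>
    obtain ⟨s₀, h₀⟩ := ih
    obtain ⟨s₁, h₁⟩ := exists_const_of_monotone_of_le (monotone_length_cellsOf_alloc (b :: x))
      fun s => (isTable_alloc s).length_cellsOf_le _
    refine ⟨max s₀ s₁, fun s hs hpoor => ?_⟩
    have hcells (t : ℕ) (ht : s ≤ t) : cellsOf (alloc t) (b :: x) = cellsOf (alloc s) (b :: x) := by
      induction t, ht using Nat.le_induction with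
      | base => rfl
      | succ t ht ih =>
        rw [← ih]
        have e := (h₁ (t + 1) (by omega)).trans (h₁ t (by omega)).symm
        simp only [alloc] at e ⊢
        rcases allocStep_eq (alloc t) t with h | ⟨y, x', h, -⟩ <;> rw [h] at e ⊢
        by_cases hx : x' = b :: x <;> simp [cellsOf, hx] at e ⊢
    -- Pairing makes every string come up at arbitrarily late stages; this one is at least `s` and
    -- considers `b :: x`.
    let t := Nat.pair (Encodable.encode (b :: x)) s
    have ht : s ≤ t := Nat.right_le_pair _ _
    -- Poverty persists: the cells are frozen, while the universal test can only reject more.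
    have hpoor' : IsPoor (alloc t) t (b :: x) := by
      rw [(isTable_alloc _).isPoor_iff] at hpoor ⊢
      refine (measureReal_mono ?_).trans_lt hpoor
      refine (live_anti_stage _ ht _).trans ?_
      rw [live, hcells t ht, live]
    have hlt := length_cellsOf_alloc_lt (s := t) (by rw [Nat.unpair_pair, decodeString_encode]) hpoor'
      (h₀ t (by omega))
    rw [hcells t ht, hcells (t + 1) (by omega)] at hlt
    exact lt_irrefl _ hlt

/-- Every sequence `α` is the image of a sequence that passes the universal test. -/
theorem exists_preimage (α : BinSeq) : ∃ ω : BinSeq,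
    (∀ s, ω ∉ openOf (universalStrings s)) ∧
      ∀ n, ∃ s, (revPrefix ω (2 * n), revPrefix α n) ∈ alloc s := by
  let K (n : ℕ) : Set BinSeq := {ω | ∃ s, (revPrefix ω (2 * n), revPrefix α n) ∈ alloc s} \
    openOf (universalStrings n)
  -- Although `s` ranges over all stages, the table condition depends on `2 * n` bits only and so is
  -- clopen.
  have hclosed (n : ℕ) : IsClosed (K n) :=
    (isClosed_setOf_revPrefix (2 * n) fun z => ∃ s, (z, revPrefix α n) ∈ alloc s).sdiff
      (isOpen_openOf _)
  have hanti (n : ℕ) : K (n + 1) ⊆ K n := by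
    rintro ω ⟨⟨s, hs⟩, hU⟩
    refine ⟨⟨s, ?_⟩, fun h => hU (openOf_mono (universalStrings_mono (Nat.le_succ n)) h)⟩
    obtain ⟨b, c, y, e, hm⟩ := (isTable_alloc s).parent _ hs (by simp [revPrefix])
    simp only [mul_add, revPrefix, List.cons.injEq] at e
    obtain ⟨-, -, rfl⟩ := e
    exact hm
  have hne (n : ℕ) : (K n).Nonempty := by
    obtain ⟨s₀, h₀⟩ := eventually_not_isPoor (revPrefix α n)
    have hT := isTable_alloc (max s₀ n)
    have h := h₀ (max s₀ n) (le_max_left _ _)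
    rw [hT.isPoor_iff, not_lt] at h
    have hpos := lt_of_lt_of_le (by positivity) h
    obtain ⟨ω, hω, hU⟩ := nonempty_of_measureReal_ne_zero hpos.ne'
    rw [hT.mem_openOf_cellsOf, length_revPrefix] at hω
    exact ⟨ω, ⟨_, hω⟩,
      fun h => hU (openOf_mono (universalStrings_mono (le_max_right _ _)) h)⟩
  obtain ⟨ω, hω⟩ := IsCompact.nonempty_iInter_of_sequence_nonempty_isCompact_isClosed K hanti hne
    (hclosed 0).isCompact hclosed
  rw [Set.mem_iInter] at hω
  exact ⟨ω, fun s => (hω s).2, fun n => (hω n).1⟩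

/-! ### The construction is primitive recursive -/

theorem primrec_cellsOf : Primrec₂ cellsOf := by
  have h : PrimrecRel fun (p : List Bool × List Bool) (x : List Bool) => p.2 = x :=
    Primrec.eq.comp (Primrec.snd.comp Primrec.fst) Primrec.snd
  exact Primrec.list_map h.listFilter (Primrec.fst.comp Primrec.snd)

theorem primrec_candidates : Primrec₂ candidates :=
  Primrec.list_flatMap primrec_cellsOf (Primrec.list_map (Primrec.const _)
    (Primrec.list_append.comp Primrec.snd (Primrec.snd.comp Primrec.fst)))

theorem primrecRel_isPoor :
    PrimrecRel fun (p : List (List Bool × List Bool) × ℕ) x => IsPoor p.1 p.2 x := by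
  have hlen : Primrec fun q : (List (List Bool × List Bool) × ℕ) × List Bool => 2 * q.2.length :=
    Primrec.nat_mul.comp (Primrec.const 2) (Primrec.list_length.comp Primrec.snd)
  have hdepth : Primrec fun q : (List (List Bool × List Bool) × ℕ) × List Bool =>
      q.1.2 + 2 * q.2.length :=
    Primrec.nat_add.comp (Primrec.snd.comp Primrec.fst) hlen
  have hR : PrimrecRel fun (z : List Bool) (q : (List (List Bool × List Bool) × ℕ) × List Bool) =>
      Hits (cellsOf q.1.1 q.2) z ∧ ¬ Hits (universalStrings q.1.2) z :=
    PrimrecPred.and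
      (primrecRel_hits.comp (primrec_cellsOf.comp (Primrec.fst.comp (Primrec.fst.comp Primrec.snd))
        (Primrec.snd.comp Primrec.snd)) Primrec.fst)
      (PrimrecPred.not (primrecRel_hits.comp (primrec_universalStrings.comp
        (Primrec.snd.comp (Primrec.fst.comp Primrec.snd))) Primrec.fst))
  exact Primrec.nat_lt.comp (Primrec.nat_mul.comp (primrec_two_pow.comp (Primrec.succ.comp hlen))
    (Primrec.list_length.comp (hR.listFilter.comp (primrec_boolStrings.comp hdepth) Primrec.id)))
    (primrec_two_pow.comp hdepth)

theorem primrecRel_isFree :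
    PrimrecRel fun y (p : List (List Bool × List Bool) × ℕ) => IsFree p.1 p.2 y := by
  have hR : PrimrecRel fun (p : List Bool × List Bool) (y : List Bool) => p.1 ≠ y :=
    PrimrecPred.not (Primrec.eq.comp (Primrec.fst.comp Primrec.fst) Primrec.snd)
  have hS : PrimrecRel fun (z : List Bool) (q : List Bool × (List (List Bool × List Bool) × ℕ)) =>
      q.1 <:+ z ∧ ¬ Hits (universalStrings q.2.2) z :=
    PrimrecPred.and (primrecRel_suffix.comp (Primrec.fst.comp Primrec.snd) Primrec.fst)
      (PrimrecPred.not (primrecRel_hits.comp (primrec_universalStrings.comp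
        (Primrec.snd.comp (Primrec.snd.comp Primrec.snd))) Primrec.fst))
  exact PrimrecPred.and
    (hR.forall_mem_list.comp (Primrec.fst.comp Primrec.snd) Primrec.fst)
    (hS.exists_mem_list.comp (primrec_boolStrings.comp (Primrec.nat_add.comp
      (Primrec.snd.comp Primrec.snd) (Primrec.list_length.comp Primrec.fst))) Primrec.id)

theorem primrec_firstFree :
    Primrec₂ fun (p : List (List Bool × List Bool) × ℕ) x => firstFree p.1 p.2 x :=
  Primrec.list_head?.comp (primrecRel_isFree.listFilter.comp
    (primrec_candidates.comp (Primrec.fst.comp Primrec.fst) (Primrec.list_tail.comp Primrec.snd))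
    Primrec.fst)

theorem primrec_allocStep : Primrec₂ allocStep := by
  have hx : Primrec fun p : List (List Bool × List Bool) × ℕ => decodeString p.2.unpair.1 :=
    primrec_decodeString.comp (Primrec.fst.comp (Primrec.unpair.comp Primrec.snd))
  exact Primrec.ite
    ((PrimrecPred.not (Primrec.eq.comp hx (Primrec.const []))).and
      (primrecRel_isPoor.comp Primrec.id hx))
    (Primrec.list_append.comp (Primrec.optionToList.comp (Primrec.option_map
      (primrec_firstFree.comp Primrec.id hx)
      (Primrec.pair Primrec.snd (hx.comp Primrec.fst)))) Primrec.fst)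
    Primrec.fst

theorem primrec_alloc : Primrec alloc := by
  refine (Primrec.nat_rec₁ [([], [])]
    (primrec_allocStep.comp Primrec.snd Primrec.fst).to₂).of_eq fun s => ?_
  induction s with
  | zero => rfl
  | succ s ih => simp only [alloc, ← ih]

/-- The last output bit that the table of stage `s` assigns to the (backwards) input `y`. -/
def lastBit (s : ℕ) (y : List Bool) : Option Bool :=
  ((alloc s).lookup y).bind List.head?

theorem primrec_lastBit : Primrec₂ lastBit := by
  have h : Primrec₂ (List.lookup : List Bool → List (List Bool × List Bool) → _) := by
    convert Primrec.listLookup (α := List Bool) (β := List Bool)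
  exact Primrec.option_bind (h.comp Primrec.snd (primrec_alloc.comp Primrec.fst))
    (Primrec.list_head?.comp Primrec.snd)

theorem mem_of_lookup_eq_some {α β : Type*} [BEq α] [LawfulBEq α] {l : List (α × β)} {a : α} {b : β}
    (h : l.lookup a = some b) : (a, b) ∈ l := by
  obtain ⟨l₁, l₂, rfl, -⟩ := List.lookup_eq_some_iff.1 h
  simp

theorem lookup_alloc_eq_some {s : ℕ} {y x : List Bool} (h : (y, x) ∈ alloc s) :
    (alloc s).lookup y = some x := by
  cases e : (alloc s).lookup y with
  | none =>
    rw [List.lookup_eq_none_iff] at e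
    simpa using e _ h
  | some x' =>
    rw [(isTable_alloc s).output_unique h (mem_of_lookup_eq_some e)]

theorem lastBit_of_mem {s : ℕ} {y x : List Bool} {b : Bool} (h : (y, b :: x) ∈ alloc s) :
    lastBit s y = some b := by
  simp [lastBit, lookup_alloc_eq_some h]

/-- Tables only grow and give one output per input, so a search may trust the first stage that
answers. -/
theorem eq_of_lastBit_eq_some {s t : ℕ} {y x : List Bool} {b c : Bool}
    (h : (y, b :: x) ∈ alloc s) (hc : lastBit t y = some c) : c = b := by
  obtain ⟨x', hx', hc⟩ := Option.bind_eq_some_iff.1 hc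
  have h₁ := alloc_mono (le_max_right s t) (mem_of_lookup_eq_some hx')
  have h₂ := alloc_mono (le_max_left s t) h
  rw [(isTable_alloc _).output_unique h₁ h₂] at hc
  simpa using hc.symm

/-! ### The mapping computed by an oracle machine, and its use -/

namespace OracleMachine

variable (M : OracleMachine)

theorem run_output_prefix (ω : BinSeq) {s t : ℕ} (h : s ≤ t) :
    (M.run ω s).2 <+: (M.run ω t).2 := by
  induction t, h using Nat.le_induction with
  | base => exact List.prefix_rfl
  | succ t _ ih => exact ih.trans (List.prefix_append _ _)

theorem run_output_unique {ω : BinSeq} {s t n : ℕ} {b c : Bool}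
    (hb : (M.run ω s).2[n]? = some b) (hc : (M.run ω t).2[n]? = some c) : b = c := by
  have key {s : ℕ} {b : Bool} (hb : (M.run ω s).2[n]? = some b) {u : ℕ} (h : s ≤ u) :
      (M.run ω u).2[n]? = some b := by
    obtain ⟨l, hl⟩ := M.run_output_prefix ω h
    rw [← hl, List.getElem?_append_left (List.getElem?_eq_some_iff.1 hb).1, hb]
  exact Option.some.inj ((key hb (le_max_left s t)).symm.trans (key hc (le_max_right s t)))

open Classical in
/-- The `n`-th bit that `M` writes on input `ω`, if there is one. -/
noncomputable def outputBit (ω : BinSeq) (n : ℕ) : Option Bool :=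
  if h : ∃ b t, (M.run ω t).2[n]? = some b then some h.choose else none

theorem outputBit_eq_some_iff {ω : BinSeq} {n : ℕ} {b : Bool} :
    M.outputBit ω n = some b ↔ ∃ t, (M.run ω t).2[n]? = some b := by
  unfold outputBit
  split_ifs with h
  · obtain ⟨t, ht⟩ := h.choose_spec
    constructor
    · rintro e
      rw [Option.some.inj e] at ht
      exact ⟨t, ht⟩
    · rintro ⟨t', ht'⟩
      rw [M.run_output_unique ht ht']
  · simp only [false_iff]
    exact fun h' => h ⟨b, h'⟩

/-- The mapping computed by an oracle machine. -/
noncomputable def output (ω : BinSeq) : FinInfSeq :=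
  ⟨M.outputBit ω, by
    intro n h
    by_contra hne
    obtain ⟨b, hb⟩ := Option.ne_none_iff_exists'.1 hne
    obtain ⟨t, ht⟩ := M.outputBit_eq_some_iff.1 hb
    have hlt : n < (M.run ω t).2.length := by
      have := (List.getElem?_eq_some_iff.1 ht).1
      omega
    have := M.outputBit_eq_some_iff.2 ⟨t, List.getElem?_eq_getElem hlt⟩
    simp [h] at this⟩

theorem output_get?_eq_some_iff {ω : BinSeq} {n : ℕ} {b : Bool} :
    (M.output ω).get? n = some b ↔ ∃ t, (M.run ω t).2[n]? = some b :=
  M.outputBit_eq_some_iff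

theorem computes_output : M.Computes M.output :=
  fun _ _ _ => M.output_get?_eq_some_iff

variable {M}

/-- While fewer than `n` bits have been written, every query is below `u n`, so both runs see the
same answers. -/
theorem run_congr {u : ℕ → ℕ} (hu : Monotone u) (hM : M.UseBoundedBy u) {ω ω' : BinSeq} {n t : ℕ}
    (h : ∀ i < u n, ω i = ω' i) (ht : ∀ s < t, (M.run ω s).2.length < n) :
    M.run ω t = M.run ω' t := by
  induction t with
  | zero => rfl
  | succ t ih =>
    have ih := ih fun s hs => ht s (by omega)
    have hq : (M.query (M.run ω t).1).map ω = (M.query (M.run ω t).1).map ω' := by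
      cases hi : M.query (M.run ω t).1 with
      | none => rfl
      | some i =>
        have := hM ω t i hi
        exact congrArg some (h i (this.trans_le (hu (ht t (by omega)))))
    rw [run, run, hq, ih]

theorem outputDependsOnFirst_output {u : ℕ → ℕ} (hu : Monotone u) (hM : M.UseBoundedBy u) :
    OutputDependsOnFirst M.output u := by
  have key {n m : ℕ} {ω ω' : BinSeq} (h : ∀ i < u n, ω i = ω' i) (hm : m < n) {b : Bool}
      (hb : (M.output ω).get? m = some b) : (M.output ω').get? m = some b := by
    rw [output_get?_eq_some_iff] at hb ⊢
    have hex : ∃ t, m < (M.run ω t).2.length := by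
      obtain ⟨t, ht⟩ := hb
      exact ⟨t, (List.getElem?_eq_some_iff.1 ht).1⟩
    classical
    -- The first moment with more than `m` output bits: before it at most `m < n` bits are written,
    -- so the runs agree up to there.
    refine ⟨Nat.find hex, ?_⟩
    rw [← run_congr hu hM h fun s hs => (not_lt.1 (Nat.find_min hex hs)).trans_lt hm]
    obtain ⟨t, ht⟩ := hb
    have hlt := Nat.find_spec hex
    rw [← M.run_output_unique (List.getElem?_eq_getElem hlt) ht]
    exact List.getElem?_eq_getElem hlt
  intro n ω ω' h m hm
  ext b
  exact ⟨key h hm, key (fun i hi => (h i hi).symm) hm⟩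

end OracleMachine

/-! ### The machine driven by the table -/

/-- A configuration `(y, 0)` means that the next input bit is to be appended to the (backwards)
input `y` read so far; `(y, s + 1)` means that the table of stage `s` is searched for `y`. -/
abbrev TableConfig : Type := List Bool × ℕ

namespace TableConfig

/-- The input position to be read. -/
def query (q : TableConfig) : Option ℕ := if q.2 = 0 then some q.1.length else none

/-- The output bit to be written. -/
def write (q : TableConfig) : Option Bool := if q.2 = 0 then none else lastBit (q.2 - 1) q.1

/-- The next configuration. -/
def next (q : TableConfig) (a : Option Bool) : TableConfig :=
  -- The default `false` plays no role in a run, since a bit is always read here. Even length before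
  -- reading means that the second bit of the pair is still to come.
  if q.2 = 0 then (a.getD false :: q.1, if q.1.length % 2 = 0 then 0 else 1)
  else (q.1, if (lastBit (q.2 - 1) q.1).isSome then 0 else q.2 + 1)

/-- The configuration with a given code. -/
def ofCode (n : ℕ) : TableConfig := (Encodable.decode n).getD ([], 0)

@[simp] theorem ofCode_encode (q : TableConfig) : ofCode (Encodable.encode q) = q := by
  simp [ofCode]

theorem primrec_ofCode : Primrec ofCode :=
  Primrec.option_getD.comp Primrec.decode (Primrec.const _)

theorem primrec_query : Primrec query :=
  Primrec.ite (Primrec.eq.comp Primrec.snd (Primrec.const 0))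
    (Primrec.option_some.comp (Primrec.list_length.comp Primrec.fst)) (Primrec.const none)

theorem primrec_write : Primrec write :=
  Primrec.ite (Primrec.eq.comp Primrec.snd (Primrec.const 0)) (Primrec.const none)
    (primrec_lastBit.comp (Primrec.nat_sub.comp Primrec.snd (Primrec.const 1)) Primrec.fst)

theorem primrec_next : Primrec₂ next := by
  have hq : Primrec fun p : TableConfig × Option Bool => p.1.1 := Primrec.fst.comp Primrec.fst
  have hs : Primrec fun p : TableConfig × Option Bool => p.1.2 := Primrec.snd.comp Primrec.fst
  refine Primrec.ite (Primrec.eq.comp hs (Primrec.const 0)) ?_ ?_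
  · exact Primrec.pair
      (Primrec.list_cons.comp (Primrec.option_getD.comp Primrec.snd (Primrec.const false)) hq)
      (Primrec.ite (Primrec.eq.comp (Primrec.nat_mod.comp (Primrec.list_length.comp hq)
        (Primrec.const 2)) (Primrec.const 0)) (Primrec.const 0) (Primrec.const 1))
  · exact Primrec.pair hq (Primrec.ite
      (Primrec.eq.comp (Primrec.option_isSome.comp (primrec_lastBit.comp
        (Primrec.nat_sub.comp hs (Primrec.const 1)) hq)) (Primrec.const true))
      (Primrec.const 0) (Primrec.succ.comp hs))

end TableConfig

/-- The machine that reads two input bits, searches the tables until one of them assigns an output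
to the input read so far, writes the last bit of this output, and starts again. -/
def tableMachine : OracleMachine where
  query n := (TableConfig.ofCode n).query
  write n := (TableConfig.ofCode n).write
  next n a := Encodable.encode ((TableConfig.ofCode n).next a)
  computable_query := (TableConfig.primrec_query.comp TableConfig.primrec_ofCode).to_comp
  computable_write := (TableConfig.primrec_write.comp TableConfig.primrec_ofCode).to_comp
  computable_next := (Primrec.encode.comp (TableConfig.primrec_next.comp
    (TableConfig.primrec_ofCode.comp Primrec.fst) Primrec.snd)).to_comp

namespace tableMachine

theorem run_zero (ω : BinSeq) :
    tableMachine.run ω 0 = (Encodable.encode (([], 0) : TableConfig), []) := rfl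

theorem run_succ {ω : BinSeq} {t : ℕ} {q : TableConfig} {o : List Bool}
    (h : tableMachine.run ω t = (Encodable.encode q, o)) :
    tableMachine.run ω (t + 1) =
      (Encodable.encode (q.next (q.query.map ω)), o ++ q.write.toList) := by
  rw [OracleMachine.run, h]
  simp [tableMachine]

/-- Rounding in `q.1.length / 2` allows for a half-read pair; during a search one full pair is ahead
of the output. This yields the bound on the use. -/
theorem run_spec (ω : BinSeq) (t : ℕ) : ∃ (q : TableConfig) (o : List Bool),
    tableMachine.run ω t = (Encodable.encode q, o) ∧
      (q.2 = 0 → q.1.length / 2 = o.length) ∧ (q.2 ≠ 0 → q.1.length = 2 * (o.length + 1)) := by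
  induction t with
  | zero => exact ⟨_, _, run_zero ω, by simp, by simp⟩
  | succ t ih =>
    obtain ⟨⟨y, s⟩, o, h, h₀, h₁⟩ := ih
    refine ⟨_, _, run_succ h, ?_⟩
    simp only [TableConfig.next, TableConfig.write] at *
    cases s with
    | zero =>
      specialize h₀ rfl
      by_cases hp : y.length % 2 = 0 <;> simp [hp] <;> omega
    | succ s =>
      specialize h₁ (by simp)
      cases hb : lastBit s y with
      | none => simpa [hb] using h₁
      | some b => simp [hb]; omega

theorem useBoundedBy : tableMachine.UseBoundedBy fun n => 2 * n := by
  intro ω t i hi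
  obtain ⟨q, o, h, h₀, -⟩ := run_spec ω t
  rw [h] at hi ⊢
  have hi : q.query = some i := by simpa [tableMachine] using hi
  unfold TableConfig.query at hi
  split_ifs at hi with hq
  specialize h₀ hq
  have := Option.some.inj hi
  show i < 2 * (o.length + 1)
  omega

theorem run_search {ω : BinSeq} {t : ℕ} {y o : List Bool}
    (h : tableMachine.run ω t = (Encodable.encode ((y, 1) : TableConfig), o)) {k : ℕ}
    (hk : ∀ r < k, lastBit r y = none) :
    tableMachine.run ω (t + k) = (Encodable.encode ((y, k + 1) : TableConfig), o) := by
  induction k with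
  | zero => exact h
  | succ k ih =>
    rw [← add_assoc, run_succ (ih fun r hr => hk r (by omega))]
    simp [TableConfig.next, TableConfig.write, hk k (by omega)]

theorem exists_run_eq {ω α : BinSeq}
    (h : ∀ n, ∃ s, (revPrefix ω (2 * n), revPrefix α n) ∈ alloc s) (n : ℕ) :
    ∃ t, tableMachine.run ω t =
      (Encodable.encode ((revPrefix ω (2 * n), 0) : TableConfig), (revPrefix α n).reverse) := by
  induction n with
  | zero => exact ⟨0, run_zero ω⟩
  | succ n ih =>
    obtain ⟨t, ht⟩ := ih
    have h₁ : tableMachine.run ω (t + 2) =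
        (Encodable.encode ((revPrefix ω (2 * (n + 1)), 1) : TableConfig),
          (revPrefix α n).reverse) := by
      rw [run_succ (run_succ ht)]
      simp [TableConfig.next, TableConfig.write, TableConfig.query, mul_add, revPrefix,
        Nat.add_mod]
    obtain ⟨s, hs⟩ := h (n + 1)
    have hex : ∃ s, (lastBit s (revPrefix ω (2 * (n + 1)))).isSome :=
      ⟨s, by rw [lastBit_of_mem hs]; rfl⟩
    -- The machine stops at the first table that answers, which may precede the given stage `s` but
    -- yields the same bit.
    have h₂ := run_search h₁ (k := Nat.find hex) fun r hr => by
      simpa using Nat.find_min hex hr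
    obtain ⟨b, hb⟩ := Option.isSome_iff_exists.1 (Nat.find_spec hex)
    refine ⟨_, (run_succ h₂).trans ?_⟩
    obtain rfl := eq_of_lastBit_eq_some hs hb
    simp [TableConfig.next, TableConfig.write, hb, revPrefix]

theorem output_eq {ω α : BinSeq}
    (h : ∀ n, ∃ s, (revPrefix ω (2 * n), revPrefix α n) ∈ alloc s) :
    tableMachine.output ω = α.toFinInf := by
  refine Stream'.Seq.ext fun n => ?_
  have hα : α.toFinInf.get? n = some (α n) := rfl
  rw [hα, OracleMachine.output_get?_eq_some_iff]
  obtain ⟨t, ht⟩ := exists_run_eq h (n + 1)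
  refine ⟨t, ?_⟩
  rw [ht, List.getElem?_eq_getElem (by simp), getElem_reverse_revPrefix]

end tableMachine

/-! ### Turing reducibility -/

/-- The code of `b :: l` is the pair of the codes of `b` and `l` plus one, so a primitive recursion
with one oracle call per step builds the prefix. -/
theorem recursiveIn_encode_revPrefix (ω : BinSeq) :
    Nat.RecursiveIn {ω.toPFun} fun n => Part.some (Encodable.encode (revPrefix ω n)) := by
  have hstep : Nat.RecursiveIn {ω.toPFun} fun p =>
      Part.some (Nat.pair (ω p.unpair.2.unpair.1).toNat p.unpair.2.unpair.2 + 1) := by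
    have hidx : Nat.RecursiveIn {ω.toPFun} fun p => Part.some p.unpair.2.unpair.1 :=
      (Nat.RecursiveIn.comp .left .right).of_eq fun n => by simp
    have hacc : Nat.RecursiveIn {ω.toPFun} fun p => Part.some p.unpair.2.unpair.2 :=
      (Nat.RecursiveIn.comp .right .right).of_eq fun n => by simp
    have hbit : Nat.RecursiveIn {ω.toPFun} fun p =>
        Part.some (ω p.unpair.2.unpair.1).toNat :=
      (Nat.RecursiveIn.comp (.oracle _ (Set.mem_singleton _)) hidx).of_eq
        fun n => Part.bind_some _ _
    exact (Nat.RecursiveIn.comp .succ (.pair hbit hacc)).of_eq fun n => by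
      simp only [Seq.seq, Part.map_eq_map, Part.map_some, Part.bind_some]
      exact Part.bind_some _ _
  have hpair : Nat.RecursiveIn {ω.toPFun} fun n => Part.some (Nat.pair 0 n) :=
    Nat.Primrec.recursiveIn (Primrec.nat_iff.1
      (Primrec₂.natPair.comp (Primrec.const 0) Primrec.id))
  refine (Nat.RecursiveIn.comp (.prec .zero hstep) hpair).of_eq fun n => ?_
  simp
  induction n with
  | zero => rfl
  | succ n ih =>
    have hbool : (ω n).toNat = Encodable.encode (ω n) := by cases ω n <;> rfl
    simp [ih, revPrefix, hbool]

/-- Bit `n` of `α` is the last bit assigned to the first `2 * (n + 1)` bits of `ω`; an unbounded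
search over the stages finds it, as some table answers. -/
theorem turingReducible_of_alloc {ω α : BinSeq}
    (h : ∀ n, ∃ s, (revPrefix ω (2 * n), revPrefix α n) ∈ alloc s) :
    TuringReducible α.toPFun ω.toPFun := by
  have hF : Partrec fun m : ℕ =>
      (Nat.rfindOpt fun s => lastBit s (decodeString m)).map Bool.toNat := by
    refine (Partrec.rfindOpt (f := fun m s => lastBit s (decodeString m)) ?_).map ?_
    · exact (primrec_lastBit.comp Primrec.snd
        (primrec_decodeString.comp Primrec.fst)).to_comp
    · exact ((Primrec.dom_finite Bool.toNat).comp Primrec.snd).to_comp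
  have hlen : Nat.RecursiveIn {ω.toPFun} fun n => Part.some (2 * (n + 1)) :=
    Nat.Primrec.recursiveIn (Primrec.nat_iff.1
      (Primrec.nat_mul.comp (Primrec.const 2) Primrec.succ))
  rw [TuringReducible, RecursiveIn.iff_nat]
  refine (Nat.RecursiveIn.comp (Nat.Partrec.recursiveIn (Partrec.nat_iff.1 hF))
    (.comp (recursiveIn_encode_revPrefix ω) hlen)).of_eq fun n => ?_
  obtain ⟨s, hs⟩ := h (n + 1)
  have hbit : Nat.rfindOpt (fun s => lastBit s (revPrefix ω (2 * (n + 1)))) = Part.some (α n) := by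
    have hdom : (Nat.rfindOpt fun s => lastBit s (revPrefix ω (2 * (n + 1)))).Dom :=
      Nat.rfindOpt_dom.2 ⟨s, _, lastBit_of_mem hs⟩
    obtain ⟨b, hb⟩ := Part.dom_iff_mem.1 hdom
    obtain ⟨t, ht⟩ := Nat.rfindOpt_spec hb
    rw [Part.eq_some_iff.2 hb, eq_of_lastBit_eq_some hs ht]
  simp [hbit, BinSeq.toPFun]

theorem mainTheorem4 :
    ∃ (T : BinSeq → FinInfSeq) (c : ℕ),
      (∃ M : OracleMachine, M.Computes T ∧ M.UseBoundedBy fun n => 2 * n + c) ∧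
      OutputDependsOnFirst T (fun n => 2 * n + c) ∧
      ∀ α : BinSeq, ∃ ω : BinSeq,
        IsMartinLofRandom ω ∧ T ω = α.toFinInf ∧ TuringReducible α.toPFun ω.toPFun := by
  refine ⟨tableMachine.output, 0, ⟨tableMachine, tableMachine.computes_output,
    tableMachine.useBoundedBy⟩, ?_, fun α => ?_⟩
  · exact OracleMachine.outputDependsOnFirst_output (fun a b h => by simpa using h)
      tableMachine.useBoundedBy
  · obtain ⟨ω, hrandom, hω⟩ := exists_preimage α
    exact ⟨ω, isMartinLofRandom_of_forall_notMem hrandom, tableMachine.output_eq hω,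
      turingReducible_of_alloc hω⟩
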